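/- Let $A$ be a finite set of agents, let $Prop$ be a set of atomic propositions, and call subsets of $A$ groups. A reading map is a function $\alpha:A\to\mathcal P(A)$ with $a\in\alpha(a)$ for all $a\in A$. Put $\alpha(B):=\bigcup_{b\in B}\alpha(b)$ for $B\subseteq A$ and $(\alpha\circ\beta)(a):=\alpha(\beta(a))$. A class $K$ of reading maps is closed under composition if $\alpha\circ\beta\in K$ for all $\alpha,\beta\in K$. An epistemic model $\mathbf S$ consists of a set $S$ of states, an equivalence relation $\sim_a$ on $S$ for each $a\in A$, and a truth assignment $Prop\to\{0,1\}$ for each state. Put $\sim_B:=\bigcap_{b\in B}\sim_b$ (so $\sim_\emptyset=S\times S$) and let $\sim^B$ be the reflexive-transitive closure of $\bigcup_{b\in B}\sim_b$. For a reading map $\alpha$, the updated model $\mathbf S^{!\alpha}$ has the same states and truth assignments, and its relation for $b$ is $\sim_{\alpha(b)}$. For a class $K$ of reading maps, the language of $LDC{\preceq}!K$ is $$\varphi::=p\mid\neg\varphi\mid\varphi\wedge\varphi\mid D_B\varphi\mid C_B\varphi\mid B\preceq C\mid[!\alpha]\varphi\qquad(p\in Prop,\ B,C\subseteq A,\ \alpha\in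 K),$$ with $\to$, $\leftrightarrow$ defined as usual and $K_b\varphi:=D_{\{b\}}\varphi$. Atoms and Boolean connectives are interpreted as usual; $D_B$ and $C_B$ are the Kripke modalities of $\sim_B$ and $\sim^B$; $s\models B\preceq C$ iff for all $t$, $s\sim_B t$ implies $s\sim_C t$; and $s\models_{\mathbf S}[!\alpha]\varphi$ iff $s\models_{\mathbf S^{!\alpha}}\varphi$. A formula is valid if it is true at every state of every epistemic model. $LDC{\preceq}!$ is $LDC{\preceq}!K$ with $K$ the class of all reading maps. Consider the proof system for $LDC{\preceq}!K$ that consists of the following axioms and rules, for all formulas $\varphi,\psi,\eta$ of the language, all $B,C,E\subseteq A$ and all $\alpha,\beta\in K$: 1. the system $\mathbf{LD{\preceq}!}$: - all classical propositional tautologies and modus ponens; - from $\varphi$ infer $D_B\varphi$; $D_B(\varphi\to\psi)\to(D_B\varphi\to D_B\psi)$; $D_B\varphi\to\varphi$; $D_B\varphi\to D_BD_B\varphi$; $\neg D_B\varphi\to D_B\neg D_B\varphi$; - $B\preceq C$ provided that $C\subseteq B$; $(B\preceq C\wedge B\preceq E)\to B\preceq C\cup E$; $(B\preceq C\wedge C\preceq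 E)\to B\preceq E$; $B\preceq C\to D_B(B\preceq C)$; $B\preceq C\to(D_C\varphi\to D_B\varphi)$; - the reduction laws $[!\alpha]p\leftrightarrow p$; $[!\alpha]\neg\varphi\leftrightarrow\neg[!\alpha]\varphi$; $[!\alpha](\varphi\wedge\psi)\leftrightarrow[!\alpha]\varphi\wedge[!\alpha]\psi$; $[!\alpha]D_B\varphi\leftrightarrow D_{\alpha(B)}[!\alpha]\varphi$; $[!\alpha](B\preceq C)\leftrightarrow\alpha(B)\preceq\alpha(C)$; - the normality rules of item 3; 2. common knowledge: from $\varphi$ infer $C_B\varphi$; $C_B(\varphi\to\psi)\to(C_B\varphi\to C_B\psi)$; $C_B\varphi\to(\varphi\wedge\bigwedge_{b\in B}K_bC_B\varphi)$; $C_B(\varphi\to\bigwedge_{b\in B}K_b\varphi)\to(\varphi\to C_B\varphi)$; 3. normality of $[!\alpha]$: from $\varphi$ infer $[!\alpha]\varphi$; $[!\alpha](\varphi\to\psi)\to([!\alpha]\varphi\to[!\alpha]\psi)$; 4. the Composition Axiom $[!\alpha][!\beta]\varphi\leftrightarrow[!(\alpha\circ\beta)]\varphi$ (where $\alpha\circ\beta\in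 K$); 5. the $[!\alpha]C$-Induction Rule: from $\eta\to\big([!\alpha]\varphi\wedge\bigwedge_{b\in B}D_{\alpha(b)}\eta\big)$ infer $\eta\to[!\alpha]C_B\varphi$. Then this system with $K$ the class of all reading maps is sound and complete for $LDC{\preceq}!$: a formula of $LDC{\preceq}!$ is provable if and only if it is valid. Moreover, for every class $K$ of reading maps that is closed under composition, the system for $LDC{\preceq}!K$ is sound and complete: a formula of $LDC{\preceq}!K$ is provable in it if and only if it is valid. -/

import Mathlib

universe u v w

namespace ReadingLogic

/-! ## Reading maps -/

/-- A reading map on the agents `A`: agent `a` reads the bases of all agents in `read a`, always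
including her own. Groups of agents are finite sets of agents. -/
structure ReadingMap (A : Type u) where
  read : A → Finset A
  self_mem : ∀ a, a ∈ read a

namespace ReadingMap

variable {A : Type u} [DecidableEq A]

/-- The lifting to groups, `α(B) = ⋃_{b ∈ B} α(b)`. -/
def onGroup (α : ReadingMap A) (B : Finset A) : Finset A := B.biUnion α.read

/-- Functional composition, `(α ∘ β)(a) = α(β(a))`. -/
def comp (α β : ReadingMap A) : ReadingMap A where
  read a := α.onGroup (β.read a)
  self_mem a := Finset.mem_biUnion.mpr ⟨a, β.self_mem a, α.self_mem a⟩

end ReadingMap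

/-- A class of reading maps is closed under composition. -/
def CompClosed {A : Type u} [DecidableEq A] (K : Set (ReadingMap A)) : Prop :=
  ∀ α ∈ K, ∀ β ∈ K, α.comp β ∈ K

/-! ## Language -/

/-- Formulas with atoms in `P`, negation, conjunction, distributed knowledge `D_B φ`, common
knowledge `C_B φ`, comparison `B ⪯ C`, and dynamic modalities `[!α] φ` for the `α` in `K`. -/
inductive Formula (A : Type u) (P : Type v) (K : Set (ReadingMap A)) : Type (max u v)
  | atom (p : P) : Formula A P K
  | neg (φ : Formula A P K) : Formula A P K
  | and (φ ψ : Formula A P K) : Formula A P K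
  | dist (B : Finset A) (φ : Formula A P K) : Formula A P K
  | common (B : Finset A) (φ : Formula A P K) : Formula A P K
  | superior (B C : Finset A) : Formula A P K
  | dyn (α : K) (φ : Formula A P K) : Formula A P K

namespace Formula

variable {A : Type u} {P : Type v} {K : Set (ReadingMap A)}

def imp (φ ψ : Formula A P K) : Formula A P K := neg (and φ (neg ψ))

def iff (φ ψ : Formula A P K) : Formula A P K := and (imp φ ψ) (imp ψ φ)

/-- A fixed tautology, serving as the empty conjunction. -/
def top : Formula A P K := imp (superior ∅ ∅) (superior ∅ ∅)

/-- Individual knowledge `K_b φ`, an abbreviation of `D_{b} φ`. -/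
def know (b : A) (φ : Formula A P K) : Formula A P K := dist {b} φ

/-- The conjunction `⋀_{b ∈ B} f b` (in some order). -/
noncomputable def conj (B : Finset A) (f : A → Formula A P K) : Formula A P K :=
  (B.toList.map f).foldr and top

/-- Truth value of a formula as a Boolean combination of the formulas that are neither negations
nor conjunctions, the latter being evaluated by `v`. -/
def boolVal (v : Formula A P K → Prop) : Formula A P K → Prop
  | neg φ => ¬ boolVal v φ
  | and φ ψ => boolVal v φ ∧ boolVal v ψ
  | atom p => v (atom p)
  | dist B φ => v (dist B φ)
  | common B φ => v (common B φ)
  | superior B C => v (superior B C)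
  | dyn α φ => v (dyn α φ)

/-- Instances of classical propositional tautologies. -/
def Tautology (φ : Formula A P K) : Prop := ∀ v : Formula A P K → Prop, boolVal v φ

end Formula

/-! ## Semantics -/

/-- Epistemic models with set of states `S`: an equivalence relation for each agent and a truth
assignment at each state. -/
structure EpistemicModel (A : Type u) (P : Type v) (S : Type w) where
  rel : A → S → S → Prop
  equiv : ∀ a, Equivalence (rel a)
  val : S → P → Prop

namespace EpistemicModel

variable {A : Type u} {P : Type v} {S : Type w}

/-- `∼_B`, the intersection of the relations of the agents in `B`. -/
def distRel (M : EpistemicModel A P S) (B : Finset A) (s t : S) : Prop :=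
  ∀ b ∈ B, M.rel b s t

/-- `∼^B`, the reflexive-transitive closure of the union of the relations of the agents in `B`. -/
def commonRel (M : EpistemicModel A P S) (B : Finset A) : S → S → Prop :=
  Relation.ReflTransGen fun s t => ∃ b ∈ B, M.rel b s t

/-- The updated model `M^{!α}`, where the new relation of `b` is `∼_{α(b)}`. -/
def update (M : EpistemicModel A P S) (α : ReadingMap A) : EpistemicModel A P S where
  rel b := M.distRel (α.read b)
  equiv _ :=
    { refl := fun s c _ => (M.equiv c).refl s
      symm := fun h c hc => (M.equiv c).symm (h c hc)
      trans := fun h k c hc => (M.equiv c).trans (h c hc) (k c hc) }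
  val := M.val

end EpistemicModel

/-- `Sat φ M s`: the formula `φ` is true at the state `s` of the model `M`. -/
def Sat {A : Type u} {P : Type v} {K : Set (ReadingMap A)} {S : Type w} :
    Formula A P K → EpistemicModel A P S → S → Prop
  | .atom p, M, s => M.val s p
  | .neg φ, M, s => ¬ Sat φ M s
  | .and φ ψ, M, s => Sat φ M s ∧ Sat ψ M s
  | .dist B φ, M, s => ∀ t, M.distRel B s t → Sat φ M t
  | .common B φ, M, s => ∀ t, M.commonRel B s t → Sat φ M t
  | .superior B C, M, s => ∀ t, M.distRel B s t → M.distRel C s t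
  | .dyn α φ, M, s => Sat φ (M.update α) s

/-- `φ` is true at every state of every epistemic model. -/
def Valid {A : Type u} {P : Type v} {K : Set (ReadingMap A)} (φ : Formula A P K) : Prop :=
  ∀ (S : Type w) (M : EpistemicModel A P S) (s : S), Sat φ M s

/-! ## Proof system -/

open Formula in
/-- Theorems of the proof system for the language with dynamic modalities `[!α]`, `α ∈ K`. All
schemata are instantiated by formulas of that language. -/
inductive Provable {A : Type u} [DecidableEq A] {P : Type v} {K : Set (ReadingMap A)} :
    Formula A P K → Prop
  -- classical propositional logic
  | taut {φ} : Tautology φ → Provable φ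
  | mp {φ ψ} : Provable (imp φ ψ) → Provable φ → Provable ψ
  -- S5 axioms and rules for distributed knowledge
  | dist_nec {φ} (B) : Provable φ → Provable (dist B φ)
  | dist_distr (B φ ψ) : Provable (imp (dist B (imp φ ψ)) (imp (dist B φ) (dist B ψ)))
  | veracity (B φ) : Provable (imp (dist B φ) φ)
  | pos_introspection (B φ) : Provable (imp (dist B φ) (dist B (dist B φ)))
  | neg_introspection (B φ) : Provable (imp (neg (dist B φ)) (dist B (neg (dist B φ))))
  -- axioms for comparative knowledge
  | inclusion (B C : Finset A) : C ⊆ B → Provable (superior B C)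
  | additivity (B C E : Finset A) :
      Provable (imp (and (superior B C) (superior B E)) (superior B (C ∪ E)))
  | transitivity (B C E) : Provable (imp (and (superior B C) (superior C E)) (superior B E))
  | known_superiority (B C) : Provable (imp (superior B C) (dist B (superior B C)))
  | knowledge_transfer (B C φ) : Provable (imp (superior B C) (imp (dist C φ) (dist B φ)))
  -- reduction laws for reading actions
  | red_atom (α : K) (p) : Provable (iff (dyn α (atom p)) (atom p))
  | red_neg (α : K) (φ) : Provable (iff (dyn α (neg φ)) (neg (dyn α φ)))
  | red_and (α : K) (φ ψ) : Provable (iff (dyn α (and φ ψ)) (and (dyn α φ) (dyn α ψ)))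
  | red_dist (α : K) (B φ) :
      Provable (iff (dyn α (dist B φ)) (dist (α.1.onGroup B) (dyn α φ)))
  | red_superior (α : K) (B C) :
      Provable (iff (dyn α (superior B C)) (superior (α.1.onGroup B) (α.1.onGroup C)))
  -- axioms and rules for common knowledge
  | common_nec {φ} (B) : Provable φ → Provable (common B φ)
  | common_distr (B φ ψ) :
      Provable (imp (common B (imp φ ψ)) (imp (common B φ) (common B ψ)))
  | common_fixed_point (B φ) :
      Provable (imp (common B φ) (and φ (conj B fun b => know b (common B φ))))
  | common_induction (B φ) :
      Provable (imp (common B (imp φ (conj B fun b => know b φ))) (imp φ (common B φ)))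
  -- necessitation and distribution for dynamic modalities
  | dyn_nec {φ} (α : K) : Provable φ → Provable (dyn α φ)
  | dyn_distr (α : K) (φ ψ) : Provable (imp (dyn α (imp φ ψ)) (imp (dyn α φ) (dyn α ψ)))
  -- composition axiom
  | composition (α β : K) (h : α.1.comp β.1 ∈ K) (φ) :
      Provable (iff (dyn α (dyn β φ)) (dyn ⟨α.1.comp β.1, h⟩ φ))
  -- dynamic induction rule for `[!α]C_B`
  | dyn_common_induction (α : K) (B) {η φ} :
      Provable (imp η (and (dyn α φ) (conj B fun b => dist (α.1.read b) η))) →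
      Provable (imp η (dyn α (common B φ)))

end ReadingLogic

namespace ReadingLogic

open Formula

/-! ## Soundness -/

section Semantics

variable {A : Type u} {P : Type v} {K : Set (ReadingMap A)} {S : Type w}

/-! Soundness is an induction on derivations. The composition axiom holds because two successive
updates equal one update by the composed map (`update_update`).

Completeness goes through a finite pseudo-model and its unravelling. Take the finite set `Φ` of
formulas relevant to the given one, plus all comparisons `B ⪯ C`, and one maximal theory for each
consistent way of deciding `Φ`. Between these theories there is a canonical relation for every
group. The relation of a group need not be the intersection of those of its members, and `⪯` is only
a primitive predicate, so this is not yet an epistemic model.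

Unravelling repairs this. States become histories of moves labelled by groups, and an agent
identifies two histories with the same remainder once the final moves visible to her are removed. By
the tree structure, the intersection of these relations over a group is exactly connectedness by
moves visible to that group (`eqvGen_move`), and `B ⪯ C` acquires its intended meaning
(`superior_iff`).

Common knowledge has no reduction law, so the truth lemma `sat_unravel_iff` is proved for formulas
under a dynamic prefix. Closure under composition keeps the prefix down to at most one modality, and
the induction rule handles `[!α]C_B` (`withPrefix_common_mem`). -/

theorem EpistemicModel.ext_rel {M N : EpistemicModel A P S}
    (hr : ∀ a s t, M.rel a s t ↔ N.rel a s t) (hv : M.val = N.val) : M = N := by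
  obtain ⟨r, e, v⟩ := M
  obtain ⟨r', e', v'⟩ := N
  obtain rfl : r = r' := by
    funext a s t
    exact propext (hr a s t)
  obtain rfl : v = v' := hv
  rfl

theorem EpistemicModel.distRel_equivalence (M : EpistemicModel A P S) (B : Finset A) :
    Equivalence (M.distRel B) where
  refl s b _ := (M.equiv b).refl s
  symm h b hb := (M.equiv b).symm (h b hb)
  trans h k b hb := (M.equiv b).trans (h b hb) (k b hb)

theorem EpistemicModel.distRel_update [DecidableEq A] (M : EpistemicModel A P S)
    (α : ReadingMap A) (B : Finset A) (s t : S) :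
    (M.update α).distRel B s t ↔ M.distRel (α.onGroup B) s t := by
  simp only [EpistemicModel.distRel, EpistemicModel.update, ReadingMap.onGroup, Finset.mem_biUnion]
  exact ⟨fun h b ⟨c, hc, hb⟩ => h c hc b hb, fun h c hc b hb => h b ⟨c, hc, hb⟩⟩

theorem EpistemicModel.update_update [DecidableEq A] (M : EpistemicModel A P S)
    (α β : ReadingMap A) : (M.update α).update β = M.update (α.comp β) :=
  EpistemicModel.ext_rel (fun b s t => M.distRel_update α (β.read b) s t) rfl

theorem sat_imp {φ ψ : Formula A P K} {M : EpistemicModel A P S} {s : S} :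
    Sat (imp φ ψ) M s ↔ (Sat φ M s → Sat ψ M s) := by
  simp [imp, Sat]

theorem sat_iff {φ ψ : Formula A P K} {M : EpistemicModel A P S} {s : S} :
    Sat (Formula.iff φ ψ) M s ↔ (Sat φ M s ↔ Sat ψ M s) := by
  simp only [Formula.iff, Sat, sat_imp]
  exact ⟨fun h => ⟨h.1, h.2⟩, fun h => ⟨h.1, h.2⟩⟩

theorem sat_conj {B : Finset A} {f : A → Formula A P K} {M : EpistemicModel A P S} {s : S} :
    Sat (conj B f) M s ↔ ∀ b ∈ B, Sat (f b) M s := by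
  have key : ∀ l : List A, Sat ((l.map f).foldr Formula.and top) M s ↔ ∀ b ∈ l, Sat (f b) M s := by
    intro l
    induction l with
    | nil => simp [top, sat_imp]
    | cons a l ih => simp [Sat, ih]
  simpa [conj] using key B.toList

theorem boolVal_sat (M : EpistemicModel A P S) (s : S) (φ : Formula A P K) :
    boolVal (fun ψ => Sat ψ M s) φ ↔ Sat φ M s := by
  induction φ with
  | neg φ ih => simp only [boolVal, Sat, ih]
  | and φ ψ ih ih' => simp only [boolVal, Sat, ih, ih']
  | _ => rfl

theorem sat_of_provable [DecidableEq A] {φ : Formula A P K} (h : Provable φ)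
    (M : EpistemicModel A P S) (s : S) : Sat φ M s := by
  induction h generalizing M s with
  | taut h => exact (boolVal_sat M s _).1 (h _)
  | mp _ _ ih ih' => exact sat_imp.1 (ih M s) (ih' M s)
  | dist_nec B _ ih => exact fun t _ => ih M t
  | dist_distr B φ ψ =>
    simp only [sat_imp, Sat]
    exact fun h k t ht => h t ht (k t ht)
  | veracity B φ =>
    simp only [sat_imp, Sat]
    exact fun h => h s ((M.distRel_equivalence B).refl s)
  | pos_introspection B φ =>
    simp only [sat_imp, Sat]
    exact fun h t ht r hr => h r ((M.distRel_equivalence B).trans ht hr)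
  | neg_introspection B φ =>
    simp only [sat_imp, Sat]
    exact fun h t ht k => h fun r hr =>
      k r ((M.distRel_equivalence B).trans ((M.distRel_equivalence B).symm ht) hr)
  | inclusion B C hC => exact fun t ht b hb => ht b (hC hb)
  | additivity B C E =>
    simp only [sat_imp, Sat]
    rintro ⟨h, k⟩ t ht b hb
    rcases Finset.mem_union.1 hb with hb | hb
    · exact h t ht b hb
    · exact k t ht b hb
  | transitivity B C E =>
    simp only [sat_imp, Sat]
    exact fun h t ht => h.2 t (h.1 t ht)
  | known_superiority B C =>
    simp only [sat_imp, Sat]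
    exact fun h t ht r hr => (M.distRel_equivalence C).trans
      ((M.distRel_equivalence C).symm (h t ht)) (h r ((M.distRel_equivalence B).trans ht hr))
  | knowledge_transfer B C φ =>
    simp only [sat_imp, Sat]
    exact fun h k t ht => k t (h t ht)
  | red_atom α p => exact sat_iff.2 Iff.rfl
  | red_neg α φ => exact sat_iff.2 Iff.rfl
  | red_and α φ ψ => exact sat_iff.2 Iff.rfl
  | red_dist α B φ => simp only [sat_iff, Sat, EpistemicModel.distRel_update]
  | red_superior α B C => simp only [sat_iff, Sat, EpistemicModel.distRel_update]
  | common_nec B _ ih => exact fun t _ => ih M t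
  | common_distr B φ ψ =>
    simp only [sat_imp, Sat]
    exact fun h k t ht => h t ht (k t ht)
  | common_fixed_point B φ =>
    simp only [sat_imp, Sat, sat_conj, know]
    exact fun h => ⟨h s .refl, fun b hb t ht r hr =>
      h r (Relation.ReflTransGen.head ⟨b, hb, ht b (Finset.mem_singleton_self b)⟩ hr)⟩
  | common_induction B φ =>
    simp only [sat_imp, Sat, sat_conj, know]
    intro h k t ht
    induction ht with
    | refl => exact k
    | tail hr hb ih =>
      obtain ⟨b, hb, hrel⟩ := hb
      refine h _ hr ih b hb _ fun c hc => ?_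
      rwa [Finset.mem_singleton.1 hc]
  | dyn_nec α _ ih => exact ih (M.update α.1) s
  | dyn_distr α φ ψ =>
    simp only [sat_imp, Sat]
    exact fun h => h
  | composition α β h φ => simp only [sat_iff, Sat, EpistemicModel.update_update]
  | dyn_common_induction α B _ ih =>
    simp only [sat_imp, Sat, sat_conj] at ih ⊢
    intro k t ht
    -- The hole is `η`: it is the invariant that propagates along the updated relations, and it
    -- yields `φ` at each point.
    suffices h : Sat _ M t from (ih M t h).1
    induction ht with
    | refl => exact k
    | tail _ hb ih' =>
      obtain ⟨b, hb, hrel⟩ := hb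
      exact (ih M _ ih').2 b hb _ hrel

theorem boolVal_imp {v : Formula A P K → Prop} {φ ψ : Formula A P K} :
    boolVal v (imp φ ψ) ↔ (boolVal v φ → boolVal v ψ) := by
  simp [imp, boolVal]

theorem boolVal_top {v : Formula A P K → Prop} : boolVal v top := by
  simp [top, boolVal_imp]

end Semantics

/-! ## Maximal consistent theories -/

section Theories

variable {A : Type u} [DecidableEq A] {P : Type v} {K : Set (ReadingMap A)}

/-- Sets of formulas that contain all theorems and are closed under modus ponens. -/
structure IsTheory (T : Set (Formula A P K)) : Prop where
  of_provable : ∀ {φ}, Provable φ → φ ∈ T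
  mp : ∀ {φ ψ}, imp φ ψ ∈ T → φ ∈ T → ψ ∈ T

/-- Maximal consistent theories. -/
structure IsMaximalTheory (T : Set (Formula A P K)) : Prop extends IsTheory T where
  neg_mem : ∀ {φ}, neg φ ∈ T ↔ φ ∉ T

theorem IsTheory.mp_taut {T : Set (Formula A P K)} (hT : IsTheory T) {φ ψ : Formula A P K}
    (h : ∀ v, boolVal v φ → boolVal v ψ) (hφ : φ ∈ T) : ψ ∈ T :=
  hT.mp (hT.of_provable (.taut fun v => boolVal_imp.2 (h v))) hφ

theorem IsTheory.mp_taut₂ {T : Set (Formula A P K)} (hT : IsTheory T) {φ ψ χ : Formula A P K}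
    (h : ∀ v, boolVal v φ → boolVal v ψ → boolVal v χ) (hφ : φ ∈ T) (hψ : ψ ∈ T) : χ ∈ T :=
  hT.mp (hT.mp_taut (fun v => by simpa only [boolVal_imp] using h v) hφ) hψ

theorem isTheory_provable : IsTheory {φ : Formula A P K | Provable φ} := ⟨id, .mp⟩

theorem IsTheory.extend {T : Set (Formula A P K)} (hT : IsTheory T) (φ : Formula A P K) :
    IsTheory {ψ | imp φ ψ ∈ T} where
  of_provable h := hT.mp_taut (fun v hv => boolVal_imp.2 fun _ => hv) (hT.of_provable h)
  mp h k := hT.mp_taut₂ (fun v hv hw => by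
    simp only [boolVal_imp] at *
    exact fun x => hv x (hw x)) h k

/-- Lindenbaum's lemma: by Zorn there is a largest theory that omits `χ`, and such a theory is
complete. -/
theorem IsTheory.exists_maximal {T : Set (Formula A P K)} (hT : IsTheory T) {χ : Formula A P K}
    (hχ : χ ∉ T) : ∃ w, IsMaximalTheory w ∧ T ⊆ w ∧ χ ∉ w := by
  obtain ⟨w, hTw, hw⟩ := zorn_subset_nonempty {w | IsTheory w ∧ χ ∉ w}
    (fun c hc hchain ⟨t, ht⟩ => by
      refine ⟨⋃₀ c, ⟨⟨fun h => ⟨t, ht, (hc ht).1.of_provable h⟩, ?_⟩, ?_⟩,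
        fun s hs => Set.subset_sUnion_of_mem hs⟩
      · rintro φ ψ ⟨s, hs, hφ⟩ ⟨r, hr, hψ⟩
        rcases hchain.total hs hr with hsr | hrs
        · exact ⟨r, hr, (hc hr).1.mp (hsr hφ) hψ⟩
        · exact ⟨s, hs, (hc hs).1.mp hφ (hrs hψ)⟩
      · rintro ⟨s, hs, h⟩
        exact (hc hs).2 h) T ⟨hT, hχ⟩
  have hth := hw.prop.1
  -- Otherwise the theory generated by adding `φ` would still omit `χ`, against maximality. If `φ`
  -- and its negation were both missing, cases would then give `χ`.
  have key : ∀ φ, φ ∉ w → imp φ χ ∈ w := by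
    intro φ hφ
    by_contra hcon
    have hle : w ⊆ {ψ | imp φ ψ ∈ w} := fun ψ hψ =>
      hth.mp_taut (fun v hv => boolVal_imp.2 fun _ => hv) hψ
    exact hφ (hw.le_of_ge (y := {ψ | imp φ ψ ∈ w}) ⟨hth.extend φ, hcon⟩ hle
      (hth.of_provable (.taut fun v => boolVal_imp.2 id)))
  refine ⟨w, ⟨hth, fun {φ} => ⟨fun hn hp => hw.prop.2 ?_, fun hn => ?_⟩⟩, hTw, hw.prop.2⟩
  · exact hth.mp_taut₂ (fun v hv hv' => absurd hv' (by simpa only [boolVal] using hv)) hn hp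
  · by_contra hnn
    refine hw.prop.2 (hth.mp_taut₂ (fun v hv hv' => ?_) (key _ hn) (key _ hnn))
    simp only [boolVal_imp, boolVal] at hv hv'
    tauto

theorem provable_of_forall_mem {φ : Formula A P K} (h : ∀ w, IsMaximalTheory w → φ ∈ w) :
    Provable φ := by
  by_contra hn
  obtain ⟨w, hw, -, hφ⟩ := isTheory_provable.exists_maximal hn
  exact hφ (h w hw)

namespace IsMaximalTheory

variable {w : Set (Formula A P K)} (hw : IsMaximalTheory w)
include hw

theorem and_mem {φ ψ : Formula A P K} : and φ ψ ∈ w ↔ φ ∈ w ∧ ψ ∈ w :=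
  ⟨fun h => ⟨hw.mp_taut (fun _ hv => (by simpa only [boolVal] using hv : _ ∧ _).1) h,
    hw.mp_taut (fun _ hv => (by simpa only [boolVal] using hv : _ ∧ _).2) h⟩,
    fun h => hw.mp_taut₂ (fun _ hv hv' => by simpa only [boolVal] using ⟨hv, hv'⟩) h.1 h.2⟩

theorem imp_mem {φ ψ : Formula A P K} : imp φ ψ ∈ w ↔ (φ ∈ w → ψ ∈ w) := by
  simp [imp, hw.neg_mem, hw.and_mem]

theorem mem_of_imp {φ ψ : Formula A P K} (h : Provable (imp φ ψ)) (hφ : φ ∈ w) : ψ ∈ w :=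
  hw.mp (hw.of_provable h) hφ

theorem mem_iff {φ ψ : Formula A P K} (h : Provable (Formula.iff φ ψ)) : φ ∈ w ↔ ψ ∈ w := by
  have := hw.and_mem.1 (hw.of_provable h)
  exact ⟨hw.imp_mem.1 this.1, hw.imp_mem.1 this.2⟩

theorem foldr_and_mem {l : List (Formula A P K)} :
    l.foldr Formula.and top ∈ w ↔ ∀ φ ∈ l, φ ∈ w := by
  induction l with
  | nil => simpa using hw.of_provable (.taut fun v => boolVal_top)
  | cons a l ih => simp [hw.and_mem, ih]

theorem conj_mem {B : Finset A} {f : A → Formula A P K} :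
    conj B f ∈ w ↔ ∀ b ∈ B, f b ∈ w := by
  simp [conj, hw.foldr_and_mem]

theorem isTheory_dist (B : Finset A) : IsTheory {φ | dist B φ ∈ w} where
  of_provable h := hw.of_provable (.dist_nec B h)
  mp h k := hw.imp_mem.1 (hw.mem_of_imp (.dist_distr B _ _) h) k

theorem superior_refl (B : Finset A) : superior B B ∈ w :=
  hw.of_provable (.inclusion _ _ subset_rfl)

theorem superior_trans {B C E : Finset A} (h : superior B C ∈ w) (k : superior C E ∈ w) :
    superior B E ∈ w :=
  hw.mem_of_imp (.transitivity B C E) (hw.and_mem.2 ⟨h, k⟩)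

theorem dist_mono {B C : Finset A} {φ : Formula A P K} (h : superior B C ∈ w)
    (k : dist C φ ∈ w) : dist B φ ∈ w :=
  hw.imp_mem.1 (hw.mem_of_imp (.knowledge_transfer B C φ) h) k

theorem dist_superior {B C : Finset A} : dist B (superior B C) ∈ w ↔ superior B C ∈ w :=
  ⟨hw.mem_of_imp (.veracity _ _), hw.mem_of_imp (.known_superiority _ _)⟩

end IsMaximalTheory

theorem provable_dist_mono {B : Finset A} {φ ψ : Formula A P K} (h : Provable (imp φ ψ)) :
    Provable (imp (dist B φ) (dist B ψ)) :=
  .mp (.dist_distr B φ ψ) (.dist_nec B h)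

/-- Since `B ⪯ C` is equivalent to `D_B (B ⪯ C)`, negative introspection applies to failed
comparisons too. -/
theorem IsMaximalTheory.dist_neg_superior {w : Set (Formula A P K)} (hw : IsMaximalTheory w)
    {B C : Finset A} (h : superior B C ∉ w) : dist B (neg (superior B C)) ∈ w := by
  have h1 : neg (dist B (superior B C)) ∈ w := by rwa [hw.neg_mem, hw.dist_superior]
  refine hw.mem_of_imp (provable_dist_mono ?_) (hw.mem_of_imp (.neg_introspection _ _) h1)
  exact provable_of_forall_mem fun v hv => by
    simp only [hv.imp_mem, hv.neg_mem, hv.dist_superior, imp_self]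

end Theories

/-! ## Canonical relations relative to a set of formulas -/

section Canonical

variable {A : Type u} [DecidableEq A] {P : Type v} {K : Set (ReadingMap A)}

/-- The theories `w` and `v` agree on what is known, within `Φ`, by groups that `B` can see
through at `w`, and on the comparisons of these groups. -/
def CanonicalRel (Φ : Set (Formula A P K)) (B : Finset A) (w v : Set (Formula A P K)) : Prop :=
  ∀ C, superior B C ∈ w → (∀ ψ, dist C ψ ∈ Φ → (dist C ψ ∈ w ↔ dist C ψ ∈ v)) ∧
    ∀ E, superior C E ∈ w ↔ superior C E ∈ v

variable {Φ : Set (Formula A P K)} {B C : Finset A} {w v x : Set (Formula A P K)}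

theorem CanonicalRel.superior_iff (hw : IsMaximalTheory w) (h : CanonicalRel Φ B w v) :
    superior B C ∈ w ↔ superior B C ∈ v :=
  (h B (hw.superior_refl B)).2 C

omit [DecidableEq A] in
theorem CanonicalRel.of_agree (h : ∀ ψ ∈ Φ, ψ ∈ w ↔ ψ ∈ v) (hΦ : ∀ B C, superior B C ∈ Φ) :
    CanonicalRel Φ B w v :=
  fun _ _ => ⟨fun _ hψ => h _ hψ, fun _ => h _ (hΦ _ _)⟩

theorem CanonicalRel.symm (hw : IsMaximalTheory w) (h : CanonicalRel Φ B w v) :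
    CanonicalRel Φ B v w := fun C hC =>
  have k := h C ((h.superior_iff hw).2 hC)
  ⟨fun ψ hψ => (k.1 ψ hψ).symm, fun E => (k.2 E).symm⟩

theorem CanonicalRel.trans (hw : IsMaximalTheory w) (h : CanonicalRel Φ B w v)
    (k : CanonicalRel Φ B v x) : CanonicalRel Φ B w x := fun C hC =>
  have h1 := h C hC
  have h2 := k C ((h.superior_iff hw).1 hC)
  ⟨fun ψ hψ => (h1.1 ψ hψ).trans (h2.1 ψ hψ), fun E => (h1.2 E).trans (h2.2 E)⟩

/-- The definition ranges over every group that `B` sees through, so transitivity of `⪯` makes the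
conditions for `C` a subset of those for `B`. -/
theorem CanonicalRel.mono (hw : IsMaximalTheory w) (hBC : superior B C ∈ w)
    (h : CanonicalRel Φ B w v) : CanonicalRel Φ C w v :=
  fun E hE => h E (hw.superior_trans hBC hE)

theorem CanonicalRel.dist_mem (hw : IsMaximalTheory w) (h : CanonicalRel Φ B w v)
    {ψ : Formula A P K} (hψ : dist B ψ ∈ Φ) : dist B ψ ∈ w ↔ dist B ψ ∈ v :=
  (h B (hw.superior_refl B)).1 ψ hψ

/-- Extend what `B` knows at `w` to a maximal theory without `ψ`. Positive and negative
introspection, with knowledge transfer, force agreement with `w` in both directions. -/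
theorem exists_canonicalRel_not_mem (hw : IsMaximalTheory w) {ψ : Formula A P K}
    (h : dist B ψ ∉ w) : ∃ v, IsMaximalTheory v ∧ CanonicalRel Φ B w v ∧ ψ ∉ v := by
  obtain ⟨v, hv, hsub, hψ⟩ := (hw.isTheory_dist B).exists_maximal h
  refine ⟨v, hv, fun C hC => ⟨fun χ _ => ⟨fun k => ?_, fun k => ?_⟩,
    fun E => ⟨fun k => ?_, fun k => ?_⟩⟩, hψ⟩
  · exact hsub (hw.dist_mono hC (hw.mem_of_imp (.pos_introspection _ _) k))
  · by_contra hn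
    exact hv.neg_mem.1 (hsub (hw.dist_mono hC
      (hw.mem_of_imp (.neg_introspection _ _) (hw.neg_mem.2 hn)))) k
  · exact hsub (hw.dist_mono hC (hw.dist_superior.2 k))
  · by_contra hn
    exact hv.neg_mem.1 (hsub (hw.dist_mono hC (hw.dist_neg_superior hn))) k

/-- Every finite set of formulas is decided by finitely many maximal theories, in all ways that
are consistent; these can be indexed in any universe. -/
theorem exists_finite_representatives (hΦ : Φ.Finite) :
    ∃ (W : Type w) (_ : Finite W) (th : W → Set (Formula A P K)), (∀ i, IsMaximalTheory (th i)) ∧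
      ∀ v, IsMaximalTheory v → ∃ i, ∀ ψ ∈ Φ, ψ ∈ v ↔ ψ ∈ th i := by
  have hX : {T : Set (Formula A P K) | ∃ w, IsMaximalTheory w ∧ T = w ∩ Φ}.Finite := by
    refine hΦ.finite_subsets.subset ?_
    rintro _ ⟨w, -, rfl⟩
    exact Set.inter_subset_right
  have := hX.to_subtype
  choose th hth using fun i : {T : Set (Formula A P K) | ∃ w, IsMaximalTheory w ∧ T = w ∩ Φ} => i.2
  obtain ⟨n, ⟨e⟩⟩ := Finite.exists_equiv_fin
    {T : Set (Formula A P K) | ∃ w, IsMaximalTheory w ∧ T = w ∩ Φ}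
  -- `ULift (Fin n)` places the index type in the universe over which validity quantifies.
  refine ⟨ULift (Fin n), inferInstance, fun i => th (e.symm i.down), fun i => (hth _).1,
    fun v hv => ⟨⟨e ⟨v ∩ Φ, v, hv, rfl⟩⟩, fun ψ hψ => ?_⟩⟩
  have := (hth ⟨v ∩ Φ, v, hv, rfl⟩).2
  have h2 := Set.ext_iff.1 this ψ
  simpa [hψ] using h2

/-- Sets of representatives are definable by a single formula. -/
theorem exists_characteristic_formula (hΦ : Φ.Finite) {W : Type*} [Finite W]
    {th : W → Set (Formula A P K)} (U : Set W) :
    ∃ η : Formula A P K, ∀ v, IsMaximalTheory v →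
      (η ∈ v ↔ ∃ i ∈ U, ∀ ψ ∈ Φ, ψ ∈ v ↔ ψ ∈ th i) := by
  classical
  let δ : W → Formula A P K := fun i =>
    (hΦ.toFinset.toList.map fun ψ => if ψ ∈ th i then ψ else neg ψ).foldr Formula.and top
  have hδ : ∀ i v, IsMaximalTheory v → (δ i ∈ v ↔ ∀ ψ ∈ Φ, ψ ∈ v ↔ ψ ∈ th i) := by
    intro i v hv
    simp only [δ, hv.foldr_and_mem, List.mem_map, Finset.mem_toList, Set.Finite.mem_toFinset,
      forall_exists_index, and_imp, forall_apply_eq_imp_iff₂]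
    refine forall₂_congr fun ψ _ => ?_
    split_ifs with h <;> simp [h, hv.neg_mem]
  refine ⟨neg (((Set.toFinite U).toFinset.toList.map fun i => neg (δ i)).foldr
    Formula.and top), fun v hv => ?_⟩
  simp only [hv.neg_mem, hv.foldr_and_mem, List.mem_map, Finset.mem_toList,
    Set.Finite.mem_toFinset, forall_exists_index, and_imp, forall_apply_eq_imp_iff₂]
  push Not
  exact exists_congr fun i => and_congr_right fun _ => hδ i v hv

end Canonical

/-! ## Unravelling -/

/-- Models with a primitive relation for each group, and primitive comparisons of groups. -/
structure GroupModel (A : Type u) [DecidableEq A] (W : Type w) where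
  rel : Finset A → W → W → Prop
  sup : Finset A → Finset A → W → Prop
  rel_equiv : ∀ B, Equivalence (rel B)
  sup_of_subset : ∀ {B C i}, C ⊆ B → sup B C i
  sup_union : ∀ {B C E i}, sup B C i → sup B E i → sup B (C ∪ E) i
  sup_trans : ∀ {B C E i}, sup B C i → sup C E i → sup B E i
  sup_congr : ∀ {B C i j}, rel B i j → (sup B C i ↔ sup B C j)
  rel_mono : ∀ {B C i j}, sup B C i → rel B i j → rel C i j

namespace GroupModel

variable {A : Type u} [DecidableEq A] {W : Type w} {L : Type w} (G : GroupModel A W)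
  (lab : L → Finset A) (o : W)

open Classical in
/-- The last world of a history that starts from `o`. A move `(l, i)` leads to `i` if this world
is accessible for the group with label `l`, and stays at the same place otherwise. -/
noncomputable def last : List (L × W) → W
  | [] => o
  | e :: h => if G.rel (lab e.1) (last h) e.2 then e.2 else last h

theorem rel_last_cons (e : L × W) (h : List (L × W)) :
    G.rel (lab e.1) (G.last lab o h) (G.last lab o (e :: h)) := by
  rw [last]
  split_ifs with k
  · exact k
  · exact (G.rel_equiv _).refl _

open Classical in
/-- The history that remains when the final moves visible to the agent `c` are removed. -/
noncomputable def root (c : A) : List (L × W) → List (L × W)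
  | [] => []
  | e :: h => if G.sup (lab e.1) {c} (G.last lab o h) then root c h else e :: h

theorem root_suffix (c : A) (h : List (L × W)) : G.root lab o c h <:+ h := by
  induction h with
  | nil => exact List.suffix_rfl
  | cons e h ih =>
    rw [root]
    split_ifs
    · exact ih.trans (List.suffix_cons e h)
    · exact List.suffix_rfl

/-- One move that is visible to the group `C`. -/
def Move (C : Finset A) (h h' : List (L × W)) : Prop :=
  ∃ e, h' = e :: h ∧ G.sup (lab e.1) C (G.last lab o h)

/-- The histories as states of an epistemic model. -/
def unravel {P : Type v} (val : W → P → Prop) : EpistemicModel A P (List (L × W)) where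
  rel c s t := G.root lab o c s = G.root lab o c t
  equiv _ := ⟨fun _ => rfl, Eq.symm, Eq.trans⟩
  val s := val (G.last lab o s)

variable {G}

theorem sup_of_forall {B C : Finset A} {i : W} (h : ∀ c ∈ C, G.sup B {c} i) : G.sup B C i := by
  induction C using Finset.induction_on with
  | empty => exact G.sup_of_subset (Finset.empty_subset _)
  | insert a C _ ih =>
    rw [Finset.insert_eq]
    exact G.sup_union (h a (Finset.mem_insert_self a C))
      (ih fun c hc => h c (Finset.mem_insert_of_mem hc))

variable {lab o} {P : Type v} {val : W → P → Prop}

/-- Induction on total length, with `s` the longer history. If its final move is hidden from some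
`c` in `C`, then `s` is its own root for `c`, hence a suffix of `t`, and lengths force `s = t`.
Otherwise additivity makes the move visible to `C`, and it can be removed. -/
theorem eqvGen_move {C : Finset A} (s t : List (L × W))
    (h : ∀ c ∈ C, G.root lab o c s = G.root lab o c t) :
    Relation.EqvGen (G.Move lab o C) s t := by
  induction hn : s.length + t.length using Nat.strong_induction_on generalizing s t with
  | _ n ih =>
    wlog hle : t.length ≤ s.length generalizing s t
    · exact .symm _ _ (this t s (fun c hc => (h c hc).symm) (by omega) (by omega))
    by_cases hst : s = t
    · exact hst ▸ .refl s
    cases s with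
    | nil => exact absurd (List.eq_nil_of_length_eq_zero (by simpa using hle)).symm hst
    | cons e s =>
      have hsup : ∀ c ∈ C, G.sup (lab e.1) {c} (G.last lab o s) := by
        intro c hc
        by_contra hn
        have hr := h c hc
        rw [root, if_neg hn] at hr
        have hs := G.root_suffix lab o c t
        rw [← hr] at hs
        exact hst (hs.eq_of_length_le hle)
      refine .trans _ s _ (.symm _ _ (.rel _ _ ⟨e, rfl, sup_of_forall hsup⟩))
        (ih (s.length + t.length) ?_ s t (fun c hc => ?_) rfl)
      · simp at hn
        omega
      · rw [← h c hc, root, if_pos (hsup c hc)]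

theorem distRel_of_move {C : Finset A} {s t : List (L × W)} (h : G.Move lab o C s t) :
    (G.unravel lab o val).distRel C s t := by
  obtain ⟨e, rfl, he⟩ := h
  intro c hc
  have : G.sup (lab e.1) {c} (G.last lab o s) :=
    G.sup_trans he (G.sup_of_subset (Finset.singleton_subset_iff.2 hc))
  change G.root lab o c s = G.root lab o c (e :: s)
  rw [root, if_pos this]

theorem rel_last_of_eqvGen {C : Finset A} {s t : List (L × W)}
    (h : Relation.EqvGen (G.Move lab o C) s t) : G.rel C (G.last lab o s) (G.last lab o t) := by
  induction h with
  | rel s t h =>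
    obtain ⟨e, rfl, he⟩ := h
    exact G.rel_mono he (G.rel_last_cons lab o e s)
  | refl s => exact (G.rel_equiv C).refl _
  | symm _ _ _ ih => exact (G.rel_equiv C).symm ih
  | trans _ _ _ _ _ ih ih' => exact (G.rel_equiv C).trans ih ih'

theorem rel_last_of_distRel {C : Finset A} {s t : List (L × W)}
    (h : (G.unravel lab o val).distRel C s t) : G.rel C (G.last lab o s) (G.last lab o t) :=
  rel_last_of_eqvGen (eqvGen_move s t h)

theorem exists_distRel (hlab : lab.Surjective) {C : Finset A} (s : List (L × W)) {i : W}
    (h : G.rel C (G.last lab o s) i) :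
    ∃ t, (G.unravel lab o val).distRel C s t ∧ G.last lab o t = i := by
  obtain ⟨l, rfl⟩ := hlab C
  exact ⟨(l, i) :: s, distRel_of_move ⟨(l, i), rfl, G.sup_of_subset subset_rfl⟩,
    by rw [last, if_pos h]⟩

/-- The truth of `B ⪯ C` is constant along a path of moves visible to `B`, so each of them is also
visible to `C`. -/
theorem distRel_of_sup {B C : Finset A} {s t : List (L × W)}
    (h : Relation.EqvGen (G.Move lab o B) s t) (hs : G.sup B C (G.last lab o s)) :
    (G.unravel lab o val).distRel C s t := by
  have hC := (G.unravel lab o val).distRel_equivalence C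
  induction h with
  | rel s t h =>
    obtain ⟨e, rfl, he⟩ := h
    exact distRel_of_move ⟨e, rfl, G.sup_trans he hs⟩
  | refl s => exact hC.refl s
  | symm _ _ h ih => exact hC.symm (ih ((G.sup_congr (rel_last_of_eqvGen h)).2 hs))
  | trans _ _ _ h _ ih ih' =>
    exact hC.trans (ih hs) (ih' ((G.sup_congr (rel_last_of_eqvGen h)).1 hs))

theorem superior_iff (hlab : lab.Surjective) {B C : Finset A} (s : List (L × W)) :
    (∀ t, (G.unravel lab o val).distRel B s t → (G.unravel lab o val).distRel C s t) ↔
      G.sup B C (G.last lab o s) := by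
  refine ⟨fun h => ?_, fun h t ht => distRel_of_sup (eqvGen_move s t ht) h⟩
  obtain ⟨l, rfl⟩ := hlab B
  refine sup_of_forall fun c hc => ?_
  by_contra hn
  -- A move by `B` that stays at the same world: it is visible to `B`, but if hidden from `c` it
  -- makes her root longer than `s`.
  have hr := h ((l, G.last lab o s) :: s)
    (distRel_of_move ⟨_, rfl, G.sup_of_subset subset_rfl⟩) c hc
  change G.root lab o c s = G.root lab o c ((l, G.last lab o s) :: s) at hr
  rw [root, if_neg hn] at hr
  have := (G.root_suffix lab o c s).length_le
  rw [hr] at this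
  simp at this

end GroupModel

/-! ## Dynamic prefixes -/

section Prefixes

variable {A : Type u} [DecidableEq A] {P : Type v} {K : Set (ReadingMap A)}

/-- The reading map of agents that only read their own bases. -/
def ReadingMap.trivial : ReadingMap A := ⟨fun a => {a}, Finset.mem_singleton_self⟩

theorem ReadingMap.onGroup_trivial (B : Finset A) :
    (ReadingMap.trivial : ReadingMap A).onGroup B = B :=
  Finset.biUnion_singleton_eq_self

omit [DecidableEq A] in
theorem EpistemicModel.update_trivial {S : Type w} (M : EpistemicModel A P S) :
    M.update ReadingMap.trivial = M :=
  EpistemicModel.ext_rel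
    (fun a s t => by simp [EpistemicModel.update, EpistemicModel.distRel, ReadingMap.trivial]) rfl

/-- The reading map of a possibly empty prefix. -/
def prefixMap (α : Option K) : ReadingMap A := α.elim ReadingMap.trivial Subtype.val

/-- Prefixing of a formula by a dynamic modality or by nothing. -/
def withPrefix (α : Option K) (φ : Formula A P K) : Formula A P K := α.elim φ fun β => dyn β φ

/-- Composition of a prefix with a reading map. -/
def prefixComp (hK : CompClosed K) (α : Option K) (β : K) : K :=
  α.elim β fun γ => ⟨γ.1.comp β.1, hK _ γ.2 _ β.2⟩

/-- Prefixes are optional because `K` need not contain the trivial reading map. -/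
theorem EpistemicModel.update_prefixComp {S : Type w} (M : EpistemicModel A P S)
    (hK : CompClosed K) (α : Option K) (β : K) :
    (M.update (prefixMap α)).update β.1 = M.update (prefixMap (some (prefixComp hK α β))) := by
  cases α with
  | none => exact congrArg (fun N => N.update β.1) M.update_trivial
  | some α => exact M.update_update α.1 β.1

/-- The formulas that matter for the truth of a prefixed formula. -/
def prefixClosure (hK : CompClosed K) : Option K → Formula A P K → Set (Formula A P K)
  | α, .atom p => {withPrefix α (.atom p)}
  | α, .neg φ => insert (withPrefix α (.neg φ)) (prefixClosure hK α φ)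
  | α, .and φ ψ => insert (withPrefix α (.and φ ψ)) (prefixClosure hK α φ ∪ prefixClosure hK α ψ)
  | α, .dist B φ => insert (withPrefix α (.dist B φ))
      (insert (.dist ((prefixMap α).onGroup B) (withPrefix α φ)) (prefixClosure hK α φ))
  -- Having these boxed formulas in the closure lets canonical relations transport `[!α]C_B φ`.
  | α, .common B φ => insert (withPrefix α (.common B φ))
      ((fun b => .dist ((prefixMap α).read b) (withPrefix α (.common B φ))) '' B ∪
        prefixClosure hK α φ)
  | α, .superior B C => {withPrefix α (.superior B C)}
  | α, .dyn β φ => insert (withPrefix α (.dyn β φ)) (prefixClosure hK (some (prefixComp hK α β)) φ)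

theorem finite_prefixClosure (hK : CompClosed K) (α : Option K) (φ : Formula A P K) :
    (prefixClosure hK α φ).Finite := by
  induction φ generalizing α with
  | atom p => exact Set.finite_singleton _
  | neg φ ih => exact (ih α).insert _
  | and φ ψ ih ih' => exact ((ih α).union (ih' α)).insert _
  | dist B φ ih => exact ((ih α).insert _).insert _
  | common B φ ih => exact ((B.finite_toSet.image _).union (ih α)).insert _
  | superior B C => exact Set.finite_singleton _
  | dyn β φ ih => exact (ih _).insert _

theorem withPrefix_mem_prefixClosure (hK : CompClosed K) (α : Option K) (φ : Formula A P K) :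
    withPrefix α φ ∈ prefixClosure hK α φ := by
  cases φ <;> simp [prefixClosure]

theorem Provable.withPrefix_nec {φ : Formula A P K} (α : Option K) (h : Provable φ) :
    Provable (withPrefix α φ) := by
  cases α with
  | none => exact h
  | some α => exact .dyn_nec α h

namespace IsMaximalTheory

variable {w : Set (Formula A P K)} (hw : IsMaximalTheory w) (α : Option K)
include hw

theorem withPrefix_atom {p : P} : withPrefix α (.atom p) ∈ w ↔ .atom p ∈ w := by
  cases α with
  | none => rfl
  | some α => exact hw.mem_iff (.red_atom α p)

theorem withPrefix_neg {φ : Formula A P K} :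
    withPrefix α (.neg φ) ∈ w ↔ withPrefix α φ ∉ w := by
  cases α with
  | none => exact hw.neg_mem
  | some α => exact (hw.mem_iff (.red_neg α φ)).trans hw.neg_mem

theorem withPrefix_and {φ ψ : Formula A P K} :
    withPrefix α (.and φ ψ) ∈ w ↔ withPrefix α φ ∈ w ∧ withPrefix α ψ ∈ w := by
  cases α with
  | none => exact hw.and_mem
  | some α => exact (hw.mem_iff (.red_and α φ ψ)).trans hw.and_mem

theorem withPrefix_dist {B : Finset A} {φ : Formula A P K} :
    withPrefix α (.dist B φ) ∈ w ↔ .dist ((prefixMap α).onGroup B) (withPrefix α φ) ∈ w := by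
  cases α with
  | none =>
    change _ ↔ .dist (ReadingMap.trivial.onGroup B) φ ∈ w
    rw [ReadingMap.onGroup_trivial]
    rfl
  | some α => exact hw.mem_iff (.red_dist α B φ)

theorem withPrefix_superior {B C : Finset A} :
    withPrefix α (.superior B C) ∈ w ↔
      .superior ((prefixMap α).onGroup B) ((prefixMap α).onGroup C) ∈ w := by
  cases α with
  | none =>
    change _ ↔ .superior (ReadingMap.trivial.onGroup B) (ReadingMap.trivial.onGroup C) ∈ w
    rw [ReadingMap.onGroup_trivial, ReadingMap.onGroup_trivial]
    rfl
  | some α => exact hw.mem_iff (.red_superior α B C)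

theorem withPrefix_dyn (hK : CompClosed K) {β : K} {φ : Formula A P K} :
    withPrefix α (.dyn β φ) ∈ w ↔ withPrefix (some (prefixComp hK α β)) φ ∈ w := by
  cases α with
  | none => rfl
  | some α => exact hw.mem_iff (.composition α β (hK _ α.2 _ β.2) φ)

theorem withPrefix_mp {φ ψ : Formula A P K} (h : withPrefix α (imp φ ψ) ∈ w)
    (k : withPrefix α φ ∈ w) : withPrefix α ψ ∈ w := by
  cases α with
  | none => exact hw.mp h k
  | some α => exact hw.imp_mem.1 (hw.mem_of_imp (.dyn_distr α φ ψ) h) k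

theorem withPrefix_conj {B : Finset A} {f : A → Formula A P K} {b : A} (hb : b ∈ B)
    (h : withPrefix α (conj B f) ∈ w) : withPrefix α (f b) ∈ w := by
  refine hw.withPrefix_mp α (hw.of_provable (.withPrefix_nec α ?_)) h
  exact provable_of_forall_mem fun v hv => hv.imp_mem.2 fun h => hv.conj_mem.1 h b hb

theorem withPrefix_of_common {B : Finset A} {φ : Formula A P K}
    (h : withPrefix α (common B φ) ∈ w) :
    withPrefix α φ ∈ w ∧
      ∀ b ∈ B, dist ((prefixMap α).read b) (withPrefix α (common B φ)) ∈ w := by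
  have h' := (hw.withPrefix_and α).1
    (hw.withPrefix_mp α (hw.of_provable (.withPrefix_nec α (.common_fixed_point B φ))) h)
  refine ⟨h'.1, fun b hb => ?_⟩
  have := (hw.withPrefix_dist α).1 (hw.withPrefix_conj α hb h'.2)
  rwa [ReadingMap.onGroup, Finset.singleton_biUnion] at this

end IsMaximalTheory

/-- Uniform induction rule: with a prefix it is the dynamic rule, without one it follows from the
induction axiom. -/
theorem provable_withPrefix_common (α : Option K) {B : Finset A} {η φ : Formula A P K}
    (h : Provable (imp η (and (withPrefix α φ) (conj B fun b => dist ((prefixMap α).read b) η)))) :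
    Provable (imp η (withPrefix α (common B φ))) := by
  cases α with
  | some α => exact .dyn_common_induction α B h
  | none =>
    have h1 : Provable (imp η φ) := provable_of_forall_mem fun v hv => hv.imp_mem.2 fun k =>
      (hv.and_mem.1 (hv.mem_of_imp h k)).1
    have h2 : Provable (imp η (conj B fun b => know b η)) :=
      provable_of_forall_mem fun v hv => hv.imp_mem.2 fun k =>
        (hv.and_mem.1 (hv.mem_of_imp h k)).2
    have h3 : Provable (imp η (common B η)) := .mp (.common_induction B η) (.common_nec B h2)
    have h4 : Provable (imp (common B η) (common B φ)) :=
      .mp (.common_distr B η φ) (.common_nec B h1)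
    exact provable_of_forall_mem fun v hv => hv.imp_mem.2 fun k =>
      hv.mem_of_imp h4 (hv.mem_of_imp h3 k)

end Prefixes

/-! ## Completeness -/

section Completeness

variable {A : Type u} [DecidableEq A] {P : Type v} {K : Set (ReadingMap A)}

/-- The canonical relations between maximal theories indexed by `W`. -/
def canonicalGroupModel (Φ : Set (Formula A P K)) {W : Type w} {th : W → Set (Formula A P K)}
    (hth : ∀ i, IsMaximalTheory (th i)) : GroupModel A W where
  rel B i j := CanonicalRel Φ B (th i) (th j)
  sup B C i := superior B C ∈ th i
  rel_equiv _ := ⟨fun _ _ _ => ⟨fun _ _ => Iff.rfl, fun _ => Iff.rfl⟩,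
    fun {i _} h => h.symm (hth i), fun {i _ _} h k => h.trans (hth i) k⟩
  sup_of_subset {_ _ i} h := (hth i).of_provable (.inclusion _ _ h)
  sup_union {B C E i} h k := (hth i).mem_of_imp (.additivity B C E) ((hth i).and_mem.2 ⟨h, k⟩)
  sup_trans {_ _ _ i} h k := (hth i).superior_trans h k
  sup_congr {_ _ i _} h := h.superior_iff (hth i)
  rel_mono {_ _ i _} h k := k.mono (hth i) h

variable {Φ : Set (Formula A P K)} {W : Type w} {th : W → Set (Formula A P K)}

theorem exists_rel_not_mem (hth : ∀ i, IsMaximalTheory (th i))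
    (hrep : ∀ v, IsMaximalTheory v → ∃ i, ∀ ψ ∈ Φ, ψ ∈ v ↔ ψ ∈ th i)
    (hsup : ∀ B C, superior B C ∈ Φ) {B : Finset A} {ψ : Formula A P K} (hψ : ψ ∈ Φ) {i : W}
    (h : dist B ψ ∉ th i) : ∃ j, CanonicalRel Φ B (th i) (th j) ∧ ψ ∉ th j := by
  obtain ⟨v, hv, hrel, hn⟩ := exists_canonicalRel_not_mem (Φ := Φ) (hth i) h
  obtain ⟨j, hj⟩ := hrep v hv
  exact ⟨j, hrel.trans (hth i) (.of_agree hj hsup), fun k => hn ((hj ψ hψ).2 k)⟩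

/-- The induction rule is applied to the formula `η` that characterises the representatives
reachable from `i`. -/
theorem withPrefix_common_mem (hΦ : Φ.Finite) [Finite W] (hth : ∀ i, IsMaximalTheory (th i))
    (hrep : ∀ v, IsMaximalTheory v → ∃ i, ∀ ψ ∈ Φ, ψ ∈ v ↔ ψ ∈ th i)
    (hsup : ∀ B C, superior B C ∈ Φ) (α : Option K) {B : Finset A} {φ : Formula A P K}
    (hφ : withPrefix α φ ∈ Φ) {i : W}
    (h : ∀ j, Relation.ReflTransGen (fun i j => ∃ b ∈ B,
      CanonicalRel Φ ((prefixMap α).read b) (th i) (th j)) i j → withPrefix α φ ∈ th j) :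
    withPrefix α (common B φ) ∈ th i := by
  obtain ⟨η, hη⟩ := exists_characteristic_formula hΦ (th := th)
    {j | Relation.ReflTransGen (fun i j => ∃ b ∈ B,
      CanonicalRel Φ ((prefixMap α).read b) (th i) (th j)) i j}
  refine (hth i).mem_of_imp (provable_withPrefix_common α (η := η) ?_)
    ((hη _ (hth i)).2 ⟨i, .refl, fun _ _ => Iff.rfl⟩)
  refine provable_of_forall_mem fun x hx => hx.imp_mem.2 fun hηx => ?_
  obtain ⟨j, hj, hxj⟩ := (hη x hx).1 hηx
  refine hx.and_mem.2 ⟨(hxj _ hφ).2 (h j hj), hx.conj_mem.2 fun b hb => ?_⟩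
  -- A failure of the box gives a related theory without `η`; but its representative `k` is one step
  -- from `j`, hence reachable, which puts `η` in it.
  by_contra hn
  obtain ⟨v, hv, hrel, hηv⟩ := exists_canonicalRel_not_mem (Φ := Φ) hx hn
  obtain ⟨k, hk⟩ := hrep v hv
  refine hηv ((hη v hv).2 ⟨k, hj.tail ⟨b, hb, ?_⟩, hk⟩)
  exact CanonicalRel.trans (hth j) (.of_agree (fun ψ hψ => (hxj ψ hψ).symm) hsup)
    (hrel.trans hx (.of_agree hk hsup))

theorem sat_unravel_iff (hK : CompClosed K) (hΦ : Φ.Finite) [Finite W]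
    (hth : ∀ i, IsMaximalTheory (th i))
    (hrep : ∀ v, IsMaximalTheory v → ∃ i, ∀ ψ ∈ Φ, ψ ∈ v ↔ ψ ∈ th i)
    (hsup : ∀ B C, superior B C ∈ Φ) {L : Type w} {lab : L → Finset A} (hlab : lab.Surjective)
    (o : W) (φ : Formula A P K) (α : Option K) (hφ : prefixClosure hK α φ ⊆ Φ) (s : List (L × W)) :
    Sat φ (((canonicalGroupModel Φ hth).unravel lab o fun i p => .atom p ∈ th i).update
      (prefixMap α)) s ↔ withPrefix α φ ∈ th ((canonicalGroupModel Φ hth).last lab o s) := by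
  induction φ generalizing α s with
  | atom p => exact ((hth _).withPrefix_atom α).symm
  | neg φ ih =>
    rw [prefixClosure, Set.insert_subset_iff] at hφ
    rw [Sat, (hth _).withPrefix_neg, ih α hφ.2]
  | and φ ψ ih ih' =>
    rw [prefixClosure, Set.insert_subset_iff, Set.union_subset_iff] at hφ
    rw [Sat, (hth _).withPrefix_and, ih α hφ.2.1, ih' α hφ.2.2]
  | dist B φ ih =>
    rw [prefixClosure, Set.insert_subset_iff, Set.insert_subset_iff] at hφ
    simp only [Sat, (hth _).withPrefix_dist, EpistemicModel.distRel_update, ih α hφ.2.2]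
    constructor
    · intro h
      by_contra hn
      obtain ⟨j, hj, hjn⟩ := exists_rel_not_mem hth hrep hsup
        (hφ.2.2 (withPrefix_mem_prefixClosure hK α φ)) hn
      obtain ⟨t, ht, rfl⟩ := GroupModel.exists_distRel (G := canonicalGroupModel Φ hth) hlab s hj
      exact hjn (h t ht)
    · intro h t ht
      have hrel : CanonicalRel Φ _ _ _ := GroupModel.rel_last_of_distRel ht
      exact (hth _).mem_of_imp (.veracity _ _) ((hrel.dist_mem (hth _) hφ.2.1).1 h)
  | common B φ ih =>
    rw [prefixClosure, Set.insert_subset_iff, Set.union_subset_iff] at hφ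
    simp only [Sat, ih α hφ.2.2]
    constructor
    · intro h
      refine withPrefix_common_mem hΦ hth hrep hsup α
        (hφ.2.2 (withPrefix_mem_prefixClosure hK α φ)) fun j hj => ?_
      -- Canonical paths lift step by step to paths of histories starting at `s`.
      suffices hs : ∃ t, EpistemicModel.commonRel _ B s t ∧
          (canonicalGroupModel Φ hth).last lab o t = j by
        obtain ⟨t, ht, rfl⟩ := hs
        exact h t ht
      induction hj with
      | refl => exact ⟨s, .refl, rfl⟩
      | tail _ hb ih' =>
        obtain ⟨t, ht, rfl⟩ := ih'
        obtain ⟨b, hb, hrel⟩ := hb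
        obtain ⟨r, hr, rfl⟩ := GroupModel.exists_distRel
          (G := canonicalGroupModel Φ hth) hlab t hrel
        exact ⟨r, ht.tail ⟨b, hb, hr⟩, rfl⟩
    · intro h t ht
      -- The invariant along the path is `[!α]C_B φ` itself.
      suffices hs : withPrefix α (common B φ) ∈ th ((canonicalGroupModel Φ hth).last lab o t) from
        ((hth _).withPrefix_of_common α hs).1
      induction ht with
      | refl => exact h
      | tail _ hb ih' =>
        obtain ⟨b, hb, hrel⟩ := hb
        have hrel : CanonicalRel Φ _ _ _ := GroupModel.rel_last_of_distRel hrel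
        exact (hth _).mem_of_imp (.veracity _ _) ((hrel.dist_mem (hth _)
          (hφ.2.1 (Set.mem_image_of_mem _ hb))).1
            (((hth _).withPrefix_of_common α ih').2 b hb))
  | superior B C =>
    simp only [Sat, EpistemicModel.distRel_update, (hth _).withPrefix_superior]
    exact GroupModel.superior_iff hlab s
  | dyn β φ ih =>
    rw [prefixClosure, Set.insert_subset_iff] at hφ
    rw [Sat, EpistemicModel.update_prefixComp _ hK, ih _ hφ.2, (hth _).withPrefix_dyn α hK]

theorem provable_of_valid [Finite A] (hK : CompClosed K) {φ : Formula A P K}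
    (h : Valid.{u, v, w} φ) : Provable φ := by
  have hΦ : (prefixClosure hK none φ ∪
      Set.range fun p : Finset A × Finset A => superior p.1 p.2).Finite :=
    (finite_prefixClosure hK none φ).union (Set.finite_range _)
  obtain ⟨W, _, th, hth, hrep⟩ := exists_finite_representatives.{u, v, w} hΦ
  obtain ⟨n, ⟨e⟩⟩ := Finite.exists_equiv_fin (Finset A)
  refine provable_of_forall_mem fun x hx => ?_
  obtain ⟨i, hi⟩ := hrep x hx
  refine (hi φ (.inl (withPrefix_mem_prefixClosure hK none φ))).2 ?_
  -- Validity is used at the empty history, whose last world is `i`, in the trivially updated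
  -- unravelling.
  exact (sat_unravel_iff hK hΦ hth hrep (fun B C => .inr ⟨(B, C), rfl⟩)
    (lab := fun l : ULift.{w} (Fin n) => e.symm l.down)
    (e.symm.surjective.comp ULift.down_surjective) i φ none Set.subset_union_left []).1 (h _ _ _)

theorem provable_iff_valid [Finite A] (hK : CompClosed K) (φ : Formula A P K) :
    Provable φ ↔ Valid.{u, v, w} φ :=
  ⟨fun h _ M s => sat_of_provable h M s, provable_of_valid hK⟩

end Completeness

end ReadingLogic

theorem mainTheorem6 (A : Type u) [Finite A] [DecidableEq A] (P : Type v) :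
    (∀ φ : ReadingLogic.Formula A P Set.univ,
      ReadingLogic.Provable φ ↔ ReadingLogic.Valid.{u, v, w} φ) ∧
    (∀ K : Set (ReadingLogic.ReadingMap A), ReadingLogic.CompClosed K →
      ∀ φ : ReadingLogic.Formula A P K,
        ReadingLogic.Provable φ ↔ ReadingLogic.Valid.{u, v, w} φ) :=
  ⟨ReadingLogic.provable_iff_valid fun _ _ _ _ => Set.mem_univ _,
    fun _ hK => ReadingLogic.provable_iff_valid hK⟩
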